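/- Let $L=\{(x_1,x_2)\in\mathbb R^2 : x_1^2+4x_2^2=4\}$ be the ellipse parametrized by $(2\cos\theta,\sin\theta)$, $0\le\theta\le 2\pi$, and let $P$ be the uniform distribution on $L$, i.e. arc length on $L$ divided by the total length of $L$: $$dP=\frac1A\sqrt{4\sin^2\theta+\cos^2\theta}\,d\theta,\qquad A=\int_0^{2\pi}\sqrt{4\sin^2\theta+\cos^2\theta}\,d\theta .$$ For $n\in\mathbb N$ let $$V_n=\inf\Big\{\int\min_{a\in\alpha}\|x-a\|^2\,dP(x) : \alpha\subset\mathbb R^2,\ \alpha\neq\emptyset,\ \operatorname{card}(\alpha)\le n\Big\},$$ and call a nonempty set $\alpha$ with at most $n$ points for which the infimum is attained an optimal set of $n$-means for $P$. Then there is a real number $a$, equal to $1.13964$ when rounded to five decimals ($|a-1.13964|<5\cdot10^{-6}$), such that $\{(a,0),(-a,0)\}$ is an optimal set of two-means for $P$ and is the only one. The quantization error $V_2$ equals $0.961441$ when rounded to six decimals ($|V_2-0.961441|<5\cdot10^{-7}$). -/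

import Mathlib

open MeasureTheory Set
open scoped ENNReal

noncomputable section

/-- The Euclidean plane. -/
abbrev Plane : Type := EuclideanSpace ℝ (Fin 2)

/-- The distortion `∫ min_{a ∈ α} ‖x - a‖² dP(x)` of a set `α` for `P`, as an extended nonnegative
real. For finite nonempty `α` the infimum over `α` is a minimum; for `α = ∅` it is `∞`. -/
def distortion {E : Type*} [NormedAddCommGroup E] [MeasurableSpace E]
    (P : Measure E) (α : Set E) : ℝ≥0∞ :=
  ∫⁻ x, ⨅ a ∈ α, ENNReal.ofReal (‖x - a‖ ^ 2) ∂P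

/-- The `n`-th quantization error `V_n(P)`: the infimum of the distortion over all sets of at most
`n` points. -/
def quantizationError {E : Type*} [NormedAddCommGroup E] [MeasurableSpace E]
    (n : ℕ) (P : Measure E) : ℝ≥0∞ :=
  ⨅ (α : Set E) (_ : α.encard ≤ n), distortion P α

/-- `α` is an optimal set of `n`-means for `P`: it has at most `n` points and attains `V_n(P)`. -/
def IsOptimalSetOfMeans {E : Type*} [NormedAddCommGroup E] [MeasurableSpace E]
    (n : ℕ) (P : Measure E) (α : Set E) : Prop :=
  α.encard ≤ n ∧ distortion P α = quantizationError n P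

/-- The arc length measure `ds = ‖γ'(θ)‖ dθ` of a (differentiable) parametrised plane curve
`γ : [s, t] → ℝ²`, as a measure on the plane. -/
def arcLengthMeasure (γ : ℝ → Plane) (s t : ℝ) : Measure Plane :=
  ((volume.restrict (Icc s t)).withDensity fun θ => ‖deriv γ θ‖ₑ).map γ

/-- The uniform distribution on a parametrised curve: arc length divided by the total length. -/
def uniformOnCurve (γ : ℝ → Plane) (s t : ℝ) : Measure Plane :=
  (arcLengthMeasure γ s t univ)⁻¹ • arcLengthMeasure γ s t

/-- The parametrisation `θ ↦ (2 cos θ, sin θ)` of the ellipse `x₁² + 4 x₂² = 4`. -/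
def ellipseParam (θ : ℝ) : Plane := !₂[2 * Real.cos θ, Real.sin θ]

/-- The uniform distribution on the elliptical curve `x₁² + 4 x₂² = 4`. -/
def ellipseUniform : Measure Plane := uniformOnCurve ellipseParam 0 (2 * Real.pi)

/-- The parametrisation covers exactly the curve `x₁² + 4 x₂² = 4`. -/
theorem ellipseParam_image :
    ellipseParam '' Icc 0 (2 * Real.pi) = {x : Plane | x 0 ^ 2 + 4 * x 1 ^ 2 = 4} := by
  ext x
  simp only [mem_image, mem_ofPred_eq]
  constructor
  · rintro ⟨θ, -, rfl⟩
    simp only [ellipseParam, PiLp.toLp_apply, Matrix.cons_val_zero, Matrix.cons_val_one]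
    nlinarith [Real.sin_sq_add_cos_sq θ]
  · intro h
    have hz : ‖(⟨x 0 / 2, x 1⟩ : ℂ)‖ = 1 := by
      rw [Complex.norm_def, Complex.normSq_mk, Real.sqrt_eq_one]
      linarith
    have hc := Complex.norm_mul_cos_arg (⟨x 0 / 2, x 1⟩ : ℂ)
    have hs := Complex.norm_mul_sin_arg (⟨x 0 / 2, x 1⟩ : ℂ)
    set φ := Complex.arg (⟨x 0 / 2, x 1⟩ : ℂ) with hφ
    rw [hz, one_mul] at hc hs
    have key : ∃ θ ∈ Icc 0 (2 * Real.pi), Real.cos θ = x 0 / 2 ∧ Real.sin θ = x 1 := by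
      refine ⟨toIcoMod Real.two_pi_pos 0 φ, ?_, ?_, ?_⟩
      · have := toIcoMod_mem_Ico Real.two_pi_pos 0 φ
        rw [zero_add] at this
        exact ⟨this.1, this.2.le⟩
      · rw [toIcoMod, Real.cos_periodic.sub_zsmul_eq, hc]
      · rw [toIcoMod, Real.sin_periodic.sub_zsmul_eq, hs]
    obtain ⟨θ, hθ, h0, h1⟩ := key
    refine ⟨θ, hθ, ?_⟩
    ext i
    fin_cases i
    · simp [ellipseParam, h0]; ring
    · simp [ellipseParam, h1]

/-- Every point of the curve, except for the coincidence of the two endpoints, is covered once. -/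
theorem ellipseParam_injOn : InjOn ellipseParam (Ico 0 (2 * Real.pi)) := by
  intro s hs t ht h
  have h0 : Real.cos s = Real.cos t := by
    have := congrArg (fun x : Plane => x 0) h
    simpa [ellipseParam] using this
  have h1 : Real.sin s = Real.sin t := by
    have := congrArg (fun x : Plane => x 1) h
    simpa [ellipseParam] using this
  have := (Real.Angle.cos_sin_inj h0 h1)
  obtain ⟨k, hk⟩ := Real.Angle.angle_eq_iff_two_pi_dvd_sub.1 this
  have hp := Real.pi_pos
  have k1 : (k : ℝ) < 1 := by
    by_contra hc
    nlinarith [hs.1, hs.2, ht.1, ht.2, not_lt.1 hc]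
  have k2 : (-1 : ℝ) < k := by
    by_contra hc
    nlinarith [hs.1, hs.2, ht.1, ht.2, not_lt.1 hc]
  have : k = 0 := by
    have a1 : k < 1 := by exact_mod_cast k1
    have a2 : -1 < k := by exact_mod_cast k2
    omega
  subst this
  simp at hk
  linarith

end

noncomputable section

/-! ### Arc length on the ellipse -/

/-! Since min(x, y) = (x + y)/2 - |x - y|/2, the distortion of a pair p, q is E‖X‖² + (‖p‖² +
‖q‖²)/2 - E|⟨X, d⟩ - c| with d = p - q and c = (‖p‖² - ‖q‖²)/2 (`pairDistortion_eq`). Everything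
rests on the inequality (E|⟨X, d⟩ - c|)² ≤ a²‖d‖² + c², where a = E|X₁|, strict for d ≠ 0 unless d₂
= c = 0 (`absMoment_sq_lt`). With m = (p + q)/2 one has c = ⟨m, d⟩ and (‖p‖² + ‖q‖²)/2 = ‖m‖² +
‖d‖²/4, so Cauchy-Schwarz and AM-GM give distortion at least E‖X‖² - a², attained only by (±a, 0).

For |d₁| ≤ |d₂| the inequality follows from the second moments. Otherwise scale to d = (1, t) with
|t| ≤ 1: folding onto a quarter of the ellipse and a rearrangement argument give E|⟨X, d⟩ - s| ≤ a +
(t² + s²)/4 (`absMoment_one_le`), which suffices for moderate t² + s²; for large values the line ⟨x,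
d⟩ = s misses the interior of the ellipse and the moment is |s|.

Numerical bounds on a and the second moments are needed both inside this argument and for the
decimals. The speed is 3/2 · |1 - u/3| with u = exp(2iθ), so Parseval applied to a Taylor polynomial
of √(1 - u/3) yields the perimeter and the cosine moment; a is elementary up to the perimeter. -/

/-- The speed of the parametrisation of the ellipse. -/
def speed (θ : ℝ) : ℝ := √(4 * Real.sin θ ^ 2 + Real.cos θ ^ 2)

/-- The perimeter of the ellipse. -/
def perimeter : ℝ := ∫ θ in (0)..(2 * Real.pi), speed θ

@[fun_prop]
theorem continuous_speed : Continuous speed := by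
  unfold speed; fun_prop

theorem speed_sq (θ : ℝ) : speed θ ^ 2 = 1 + 3 * Real.sin θ ^ 2 := by
  rw [speed, Real.sq_sqrt (by positivity)]
  linarith [Real.sin_sq_add_cos_sq θ]

theorem speed_nonneg (θ : ℝ) : 0 ≤ speed θ := Real.sqrt_nonneg _

theorem one_le_speed (θ : ℝ) : 1 ≤ speed θ := by
  nlinarith [speed_sq θ, speed_nonneg θ, sq_nonneg (Real.sin θ)]

theorem perimeter_pos : 0 < perimeter :=
  intervalIntegral.intervalIntegral_pos_of_pos (continuous_speed.intervalIntegrable _ _)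
    (fun θ => one_pos.trans_le (one_le_speed θ)) Real.two_pi_pos

theorem continuous_ellipseParam : Continuous ellipseParam := by
  unfold ellipseParam; fun_prop

theorem hasDerivAt_ellipseParam (θ : ℝ) :
    HasDerivAt ellipseParam !₂[-2 * Real.sin θ, Real.cos θ] θ := by
  have h : HasDerivAt (fun θ : ℝ => ![2 * Real.cos θ, Real.sin θ])
      ![-2 * Real.sin θ, Real.cos θ] θ := by
    rw [hasDerivAt_pi]
    intro i
    fin_cases i
    · simpa using (Real.hasDerivAt_cos θ).const_mul 2
    · simpa using Real.hasDerivAt_sin θ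
  exact ((PiLp.continuousLinearEquiv 2 ℝ fun _ : Fin 2 => ℝ).symm.hasFDerivAt).comp_hasDerivAt θ h

theorem norm_deriv_ellipseParam (θ : ℝ) : ‖deriv ellipseParam θ‖ = speed θ := by
  rw [(hasDerivAt_ellipseParam θ).deriv, EuclideanSpace.norm_eq, speed]
  simp [Fin.sum_univ_two]
  ring_nf

theorem norm_sub_sq_plane (x a : Plane) :
    ‖x - a‖ ^ 2 = (x 0 - a 0) ^ 2 + (x 1 - a 1) ^ 2 := by
  rw [EuclideanSpace.norm_sq_eq]
  simp [Fin.sum_univ_two]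

theorem lintegral_arcLengthMeasure_ellipse {f : Plane → ℝ} (hf : Continuous f)
    (hf0 : ∀ x, 0 ≤ f x) :
    ∫⁻ x, ENNReal.ofReal (f x) ∂(arcLengthMeasure ellipseParam 0 (2 * Real.pi)) =
      ENNReal.ofReal (∫ θ in (0)..(2 * Real.pi), f (ellipseParam θ) * speed θ) := by
  have hγ := continuous_ellipseParam
  have hd : (fun θ => ‖deriv ellipseParam θ‖ₑ) = fun θ => ENNReal.ofReal (speed θ) := by
    funext θ
    rw [← norm_deriv_ellipseParam, ofReal_norm]
  have hm : Measurable fun θ => ENNReal.ofReal (speed θ) := by fun_prop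
  rw [arcLengthMeasure, hd, lintegral_map (by fun_prop) (by fun_prop),
    lintegral_withDensity_eq_lintegral_mul _ hm (by fun_prop),
    intervalIntegral.integral_of_le Real.two_pi_pos.le, ← integral_Icc_eq_integral_Ioc,
    ofReal_integral_eq_lintegral_ofReal]
  · refine lintegral_congr fun θ => ?_
    rw [Pi.mul_apply, mul_comm, ENNReal.ofReal_mul (hf0 _)]
  · exact Continuous.integrableOn_Icc (by fun_prop)
  · exact Filter.Eventually.of_forall fun θ => mul_nonneg (hf0 _) (speed_nonneg _)

theorem arcLengthMeasure_ellipse_univ :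
    arcLengthMeasure ellipseParam 0 (2 * Real.pi) univ = ENNReal.ofReal perimeter := by
  have := lintegral_arcLengthMeasure_ellipse (f := fun _ => 1) continuous_const (by simp)
  simpa [perimeter] using this

theorem lintegral_ellipseUniform {f : Plane → ℝ} (hf : Continuous f) (hf0 : ∀ x, 0 ≤ f x) :
    ∫⁻ x, ENNReal.ofReal (f x) ∂ellipseUniform =
      ENNReal.ofReal ((∫ θ in (0)..(2 * Real.pi), f (ellipseParam θ) * speed θ) / perimeter) := by
  rw [ellipseUniform, uniformOnCurve, lintegral_smul_measure, lintegral_arcLengthMeasure_ellipse hf hf0,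
    arcLengthMeasure_ellipse_univ, ENNReal.ofReal_div_of_pos perimeter_pos, smul_eq_mul,
    ENNReal.div_eq_inv_mul]

/-- The infimum defining `quantizationError` also ranges over the empty set; as the measure has mass
1, this set never competes. -/
theorem distortion_empty : distortion ellipseUniform ∅ = ∞ := by
  have h : ellipseUniform univ = 1 := by
    have := lintegral_ellipseUniform (f := fun _ => 1) continuous_const (by simp)
    have hp : ∫ θ in (0)..(2 * Real.pi), speed θ = perimeter := rfl
    simpa [hp, div_self perimeter_pos.ne'] using this
  simp [distortion, h]

/-- The squared-distance distortion of the pair `(p₁, p₂), (q₁, q₂)`. -/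
def pairDistortion (p₁ p₂ q₁ q₂ : ℝ) : ℝ :=
  (∫ θ in (0)..(2 * Real.pi),
    min ((2 * Real.cos θ - p₁) ^ 2 + (Real.sin θ - p₂) ^ 2)
      ((2 * Real.cos θ - q₁) ^ 2 + (Real.sin θ - q₂) ^ 2) * speed θ) / perimeter

theorem distortion_pair (p q : Plane) :
    distortion ellipseUniform {p, q} =
      ENNReal.ofReal (pairDistortion (p 0) (p 1) (q 0) (q 1)) := by
  have h := lintegral_ellipseUniform (f := fun x => min (‖x - p‖ ^ 2) (‖x - q‖ ^ 2))
    (by fun_prop) (fun x => by positivity)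
  simp only [norm_sub_sq_plane, ellipseParam] at h
  rw [distortion, pairDistortion]
  simp only [iInf_pair, norm_sub_sq_plane, ← ENNReal.ofReal_min]
  simpa using h

theorem pairDistortion_nonneg (p₁ p₂ q₁ q₂ : ℝ) : 0 ≤ pairDistortion p₁ p₂ q₁ q₂ :=
  div_nonneg (intervalIntegral.integral_nonneg Real.two_pi_pos.le fun θ _ =>
    mul_nonneg (by positivity) (speed_nonneg θ)) perimeter_pos.le

/-! ### Numerical values of the perimeter and of the second moments -/

theorem integral_exp_two_int_mul (n : ℤ) (hn : n ≠ 0) :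
    ∫ θ in (0)..(2 * Real.pi), Complex.exp (2 * n * Complex.I * θ) = 0 := by
  have hc : (2 * n * Complex.I : ℂ) ≠ 0 := by simp [hn]
  rw [integral_exp_mul_complex hc]
  have : Complex.exp (2 * n * Complex.I * ((2 * Real.pi : ℝ) : ℂ)) = 1 :=
    Complex.exp_eq_one_iff.2 ⟨2 * n, by push_cast; ring⟩
  rw [this]
  simp

/-- Parseval: expanding the square as a double sum, only the diagonal terms survive integration. -/
theorem integral_norm_sq_trigPoly (N : ℕ) (b : ℕ → ℝ) :
    ∫ θ in (0)..(2 * Real.pi),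
      ‖∑ k ∈ Finset.range N, (b k : ℂ) * Complex.exp (2 * θ * Complex.I) ^ k‖ ^ 2 =
    2 * Real.pi * ∑ k ∈ Finset.range N, b k ^ 2 := by
  have key : ∀ θ : ℝ,
      ((‖∑ k ∈ Finset.range N, (b k : ℂ) * Complex.exp (2 * θ * Complex.I) ^ k‖ ^ 2 : ℝ) : ℂ) =
      ∑ j ∈ Finset.range N, ∑ k ∈ Finset.range N,
        (b j * b k : ℂ) * Complex.exp (2 * ((j - k : ℤ) : ℂ) * Complex.I * θ) := by
    intro θ
    rw [← Complex.normSq_eq_norm_sq, ← Complex.mul_conj, map_sum, Finset.sum_mul_sum]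
    refine Finset.sum_congr rfl fun j _ => Finset.sum_congr rfl fun k _ => ?_
    rw [map_mul, map_pow, ← Complex.exp_conj, ← Complex.exp_nat_mul, ← Complex.exp_nat_mul]
    simp only [map_mul, Complex.conj_ofReal, Complex.conj_I, map_ofNat]
    rw [mul_mul_mul_comm, ← Complex.exp_add]
    congr 2
    push_cast
    ring
  apply Complex.ofReal_injective
  rw [← intervalIntegral.integral_ofReal]
  simp_rw [key]
  rw [Complex.ofReal_mul, Complex.ofReal_sum, Finset.mul_sum, intervalIntegral.integral_finsetSum]
  swap
  · intro j _
    exact Continuous.intervalIntegrable (by fun_prop) _ _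
  refine Finset.sum_congr rfl fun j hj => ?_
  rw [intervalIntegral.integral_finsetSum]
  swap
  · intro k _
    exact Continuous.intervalIntegrable (by fun_prop) _ _
  simp_rw [intervalIntegral.integral_const_mul]
  rw [Finset.sum_eq_single_of_mem j hj]
  · simp; ring
  · intro k _ hk
    rw [integral_exp_two_int_mul _ (by omega), mul_zero]

/-- The Taylor coefficients of `√(1 - u / 3)` up to order twelve. -/
def sqrtCoeff (k : ℕ) : ℝ :=
  ([1, -2, -2, -4, -10, -28, -84, -264, -858, -2860, -9724, -33592, -117572] : List ℝ).getD k 0 /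
    12 ^ k

/-- The Taylor polynomial of `√(1 - u / 3)` of order twelve. -/
def sqrtTaylor (u : ℂ) : ℂ := ∑ k ∈ Finset.range 13, (sqrtCoeff k : ℂ) * u ^ k

/-- The coefficients of `sqrtTaylor u ^ 2 - (1 - u / 3)`, from order thirteen on. -/
def sqrtRemCoeff (k : ℕ) : ℝ :=
  ([832048, 1307504, 3090464, 8112468, 22269520, 62354656, 175343168, 488455968, 1325809056, 3414962720, 7898957248, 13823175184] : List ℝ).getD k 0 / 12 ^ (k + 13)

/-- The remainder is an explicit polynomial, so on the unit circle it is bounded by the sum of its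
coefficients and no analytic square root is needed. -/
theorem sqrtTaylor_sq (u : ℂ) :
    sqrtTaylor u ^ 2 =
      1 - u / 3 + ∑ k ∈ Finset.range 12, (sqrtRemCoeff k : ℂ) * u ^ (k + 13) := by
  simp only [sqrtTaylor, sqrtCoeff, sqrtRemCoeff, Finset.sum_range_succ, Finset.sum_range_zero,
    List.getD_cons_zero, List.getD_cons_succ]
  push_cast
  ring

theorem norm_sqrtTaylor_sq_sub_le {u : ℂ} (hu : ‖u‖ = 1) :
    |‖sqrtTaylor u‖ ^ 2 - ‖1 - u / 3‖| ≤ 1 / 10 ^ 8 := by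
  rw [← norm_pow, sqrtTaylor_sq]
  refine (abs_norm_sub_norm_le _ _).trans ?_
  rw [add_sub_cancel_left]
  refine (norm_sum_le _ _).trans ?_
  simp only [norm_mul, norm_pow, hu, one_pow, mul_one, Complex.norm_real, Real.norm_eq_abs]
  simp only [sqrtRemCoeff, Finset.sum_range_succ, Finset.sum_range_zero,
    List.getD_cons_zero, List.getD_cons_succ]
  norm_num [abs_of_pos]

theorem exp_two_mul_I (θ : ℝ) : Complex.exp (2 * θ * Complex.I) =
    (Real.cos (2 * θ) : ℂ) + (Real.sin (2 * θ) : ℂ) * Complex.I := by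
  rw [Complex.ofReal_cos, Complex.ofReal_sin, ← Complex.exp_mul_I]
  push_cast
  rfl

/-- This identity makes the speed, up to the factor 2/3, nearly the squared modulus of a
trigonometric polynomial: |1 - u/3| ≈ |`sqrtTaylor u`|². -/
theorem norm_one_sub_exp_div_three (θ : ℝ) :
    ‖1 - Complex.exp (2 * θ * Complex.I) / 3‖ = 2 / 3 * speed θ := by
  have hs := speed_nonneg θ
  refine (sq_eq_sq₀ (norm_nonneg _) (by positivity)).1 ?_
  have he : 1 - Complex.exp (2 * θ * Complex.I) / 3 =
      ((1 - Real.cos (2 * θ) / 3 : ℝ) : ℂ) + ((-Real.sin (2 * θ) / 3 : ℝ) : ℂ) * Complex.I := by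
    rw [exp_two_mul_I]
    push_cast
    ring
  rw [mul_pow, speed_sq, he, ← Complex.normSq_eq_norm_sq, Complex.normSq_add_mul_I]
  have h1 := Real.sin_sq_add_cos_sq (2 * θ)
  have h2 := Real.cos_sq' θ
  have h3 := Real.cos_two_mul θ
  linear_combination h1 / 9 - 2 / 3 * h3 - 4 / 3 * h2

theorem abs_norm_sqrtTaylor_exp_sub_le (θ : ℝ) :
    |‖sqrtTaylor (Complex.exp (2 * θ * Complex.I))‖ ^ 2 - 2 / 3 * speed θ| ≤ 1 / 10 ^ 8 := by
  rw [← norm_one_sub_exp_div_three]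
  refine norm_sqrtTaylor_sq_sub_le ?_
  have := Complex.norm_exp_ofReal_mul_I (2 * θ)
  push_cast at this
  exact this

theorem continuous_norm_sqrtTaylor_exp :
    Continuous fun θ : ℝ => ‖sqrtTaylor (Complex.exp (2 * θ * Complex.I))‖ ^ 2 := by
  unfold sqrtTaylor; fun_prop

theorem integral_norm_sqrtTaylor_sq :
    ∫ θ in (0)..(2 * Real.pi), ‖sqrtTaylor (Complex.exp (2 * θ * Complex.I))‖ ^ 2 =
      2 * Real.pi * ∑ k ∈ Finset.range 13, sqrtCoeff k ^ 2 :=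
  integral_norm_sq_trigPoly 13 sqrtCoeff

/-- As |1 + u|² = 2 + 2 cos 2θ on the unit circle, Parseval for (1 + u) · `sqrtTaylor u`, with
coefficients `b`, produces the weight cos 2θ. -/
theorem integral_cos_mul_norm_sqrtTaylor_sq :
    ∫ θ in (0)..(2 * Real.pi),
        Real.cos (2 * θ) * ‖sqrtTaylor (Complex.exp (2 * θ * Complex.I))‖ ^ 2 =
      2 * Real.pi * ∑ k ∈ Finset.range 12, sqrtCoeff k * sqrtCoeff (k + 1) := by
  let b : ℕ → ℝ := fun k => sqrtCoeff k + if k = 0 then 0 else sqrtCoeff (k - 1)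
  have hb : ∀ u : ℂ, ∑ k ∈ Finset.range 14, (b k : ℂ) * u ^ k = (1 + u) * sqrtTaylor u := by
    intro u
    -- The index 13 lies past the end of the coefficient list, where `getD` returns 0.
    have h13 : sqrtCoeff 13 = 0 := by simp [sqrtCoeff]
    simp only [b, sqrtTaylor, Finset.sum_range_succ, Finset.sum_range_zero]
    simp only [h13]
    push_cast
    simp
    ring
  have h := integral_norm_sq_trigPoly 14 b
  have hc : ∀ θ : ℝ, ‖1 + Complex.exp (2 * θ * Complex.I)‖ ^ 2 = 2 + 2 * Real.cos (2 * θ) := by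
    intro θ
    have he : 1 + Complex.exp (2 * θ * Complex.I) =
        ((1 + Real.cos (2 * θ) : ℝ) : ℂ) + (Real.sin (2 * θ) : ℂ) * Complex.I := by
      rw [exp_two_mul_I]
      push_cast
      ring
    rw [he, ← Complex.normSq_eq_norm_sq, Complex.normSq_add_mul_I]
    linear_combination Real.sin_sq_add_cos_sq (2 * θ)
  simp_rw [hb, norm_mul, mul_pow, hc, add_mul] at h
  have hcont := continuous_norm_sqrtTaylor_exp
  rw [intervalIntegral.integral_add (Continuous.intervalIntegrable (by fun_prop) _ _)
    (Continuous.intervalIntegrable (by fun_prop) _ _)] at h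
  simp_rw [mul_assoc (2 : ℝ) (Real.cos _)] at h
  rw [intervalIntegral.integral_const_mul, intervalIntegral.integral_const_mul,
    integral_norm_sqrtTaylor_sq] at h
  have hsum : ∑ k ∈ Finset.range 14, b k ^ 2 = 2 * ∑ k ∈ Finset.range 13, sqrtCoeff k ^ 2 +
      2 * ∑ k ∈ Finset.range 12, sqrtCoeff k * sqrtCoeff (k + 1) := by
    have h13 : sqrtCoeff 13 = 0 := by simp [sqrtCoeff]
    simp only [b, Finset.sum_range_succ, Finset.sum_range_zero]
    simp only [h13]
    simp
    ring
  rw [hsum] at h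
  linarith

/-- The second cosine moment of arc length on the ellipse. -/
def cosMoment : ℝ := ∫ θ in (0)..(2 * Real.pi), Real.cos (2 * θ) * speed θ

theorem abs_integral_sub_le {f g : ℝ → ℝ} (hf : Continuous f) (hg : Continuous g) {ε : ℝ}
    (h : ∀ θ, |f θ - g θ| ≤ ε) :
    |(∫ θ in (0)..(2 * Real.pi), f θ) - ∫ θ in (0)..(2 * Real.pi), g θ| ≤ ε * (2 * Real.pi) := by
  rw [← intervalIntegral.integral_sub (hf.intervalIntegrable _ _) (hg.intervalIntegrable _ _)]
  have := intervalIntegral.norm_integral_le_of_norm_le_const (a := 0) (b := 2 * Real.pi)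
    (f := fun θ => f θ - g θ) (C := ε) (fun θ _ => h θ)
  simpa [abs_of_pos Real.pi_pos] using this

theorem abs_perimeter_sub_le : |perimeter - 9.6884482205| ≤ 1 / 10 ^ 7 := by
  have h := abs_integral_sub_le continuous_norm_sqrtTaylor_exp
    (g := fun θ => 2 / 3 * speed θ) (by fun_prop) abs_norm_sqrtTaylor_exp_sub_le
  rw [integral_norm_sqrtTaylor_sq, intervalIntegral.integral_const_mul, ← perimeter] at h
  simp only [sqrtCoeff, Finset.sum_range_succ, Finset.sum_range_zero,
    List.getD_cons_zero, List.getD_cons_succ] at h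
  norm_num at h
  have h1 := Real.pi_gt_d20
  have h2 := Real.pi_lt_d20
  rw [abs_le] at h ⊢
  constructor <;> linarith

theorem abs_cosMoment_sub_le : |cosMoment + 1.548665638| ≤ 1 / 10 ^ 7 := by
  have hc := continuous_norm_sqrtTaylor_exp
  have h := abs_integral_sub_le
    (f := fun θ => Real.cos (2 * θ) * ‖sqrtTaylor (Complex.exp (2 * θ * Complex.I))‖ ^ 2)
    (g := fun θ => 2 / 3 * (Real.cos (2 * θ) * speed θ)) (by fun_prop) (by fun_prop)
    (ε := 1 / 10 ^ 8) (fun θ => by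
      have h1 := abs_norm_sqrtTaylor_exp_sub_le θ
      have h2 := Real.abs_cos_le_one (2 * θ)
      rw [show ∀ x y z : ℝ, x * y - 2 / 3 * (x * z) = x * (y - 2 / 3 * z) from
        fun x y z => by ring, abs_mul]
      exact (mul_le_of_le_one_left (abs_nonneg _) h2).trans h1)
  rw [integral_cos_mul_norm_sqrtTaylor_sq, intervalIntegral.integral_const_mul, ← cosMoment] at h
  simp only [sqrtCoeff, Finset.sum_range_succ, Finset.sum_range_zero,
    List.getD_cons_zero, List.getD_cons_succ] at h
  norm_num at h
  have h1 := Real.pi_gt_d20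
  have h2 := Real.pi_lt_d20
  rw [abs_le] at h ⊢
  constructor <;> linarith

/-! ### Numerical value of the logarithm in the first absolute moment -/

theorem arsinh_sqrt_three_div :
    Real.arsinh √3 / √3 = 2 / √3 * (1 / 2 * Real.log ((1 + 1 / √3) / (1 - 1 / √3))) := by
  have h3 : √3 ^ 2 = 3 := Real.sq_sqrt (by norm_num)
  have h1 : 1 < √3 := Real.lt_sqrt_of_sq_lt (by norm_num)
  have hne : √3 - 1 ≠ 0 := by linarith
  have : (1 + 1 / √3) / (1 - 1 / √3) = √3 + √(1 + √3 ^ 2) := by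
    rw [h3, show (1 + 3 : ℝ) = 2 ^ 2 by norm_num, Real.sqrt_sq (by norm_num)]
    field_simp
    nlinarith
  rw [this, Real.arsinh]
  ring

theorem abs_arsinh_sqrt_three_div_sub_le :
    |Real.arsinh √3 / √3 - 0.7603459963| ≤ 1 / 10 ^ 8 := by
  have h3 : √3 ^ 2 = 3 := Real.sq_sqrt (by norm_num)
  have h1 : 1 < √3 := Real.lt_sqrt_of_sq_lt (by norm_num)
  have hx0 : 0 ≤ 1 / √3 := by positivity
  have hx1 : 1 / √3 < 1 := by rw [div_lt_one (by positivity)]; exact h1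
  -- The artanh series at 1/√3 has ratio 1/3; eighteen terms leave an error of order 3⁻¹⁸, below
  -- 10⁻⁸.
  have hlo := Real.sum_range_le_log_div hx0 hx1 18
  have hhi := Real.log_div_le_sum_range_add hx0 hx1 18
  rw [arsinh_sqrt_three_div]
  set ℓ := 1 / 2 * Real.log ((1 + 1 / √3) / (1 - 1 / √3))
  have hpos : 0 ≤ 2 / √3 := by positivity
  have hlo' := mul_le_mul_of_nonneg_left hlo hpos
  have hhi' := mul_le_mul_of_nonneg_left hhi hpos
  -- Only odd powers of 1/√3 occur, so the prefactor 2/√3 makes every term rational.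
  have hp : ∀ i : ℕ, 2 / √3 * (1 / √3) ^ (2 * i + 1) = 2 / 3 * (1 / 3) ^ i := by
    intro i
    rw [pow_succ, pow_mul, div_pow, h3]
    field_simp
    rw [h3]
  rw [mul_add, Finset.mul_sum] at hhi'
  rw [Finset.mul_sum] at hlo'
  simp only [← mul_div_assoc] at hlo' hhi'
  simp only [hp] at hlo' hhi'
  simp only [div_pow 1 √3, h3] at hlo' hhi'
  simp only [Finset.sum_range_succ, Finset.sum_range_zero] at hlo' hhi'
  norm_num at hlo' hhi'
  rw [abs_le]
  constructor <;> linarith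

/-! ### Reduction to a quarter of the ellipse -/

theorem integral_eq_integral_quarter {f : ℝ → ℝ} (hf : Continuous f) :
    ∫ θ in (0)..(2 * Real.pi), f θ =
      ∫ θ in (0)..(Real.pi / 2),
        (f θ + f (Real.pi - θ) + f (Real.pi + θ) + f (2 * Real.pi - θ)) := by
  have hi : ∀ a b, IntervalIntegrable f volume a b := fun a b => hf.intervalIntegrable a b
  rw [intervalIntegral.integral_add (Continuous.intervalIntegrable (by fun_prop) _ _)
      (Continuous.intervalIntegrable (by fun_prop) _ _),
    intervalIntegral.integral_add (Continuous.intervalIntegrable (by fun_prop) _ _)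
      (Continuous.intervalIntegrable (by fun_prop) _ _),
    intervalIntegral.integral_add (Continuous.intervalIntegrable (by fun_prop) _ _)
      (Continuous.intervalIntegrable (by fun_prop) _ _),
    intervalIntegral.integral_comp_sub_left f, intervalIntegral.integral_comp_sub_left f,
    intervalIntegral.integral_comp_add_left f, sub_zero, sub_zero, add_zero,
    show Real.pi - Real.pi / 2 = Real.pi / 2 by ring,
    show 2 * Real.pi - Real.pi / 2 = Real.pi + Real.pi / 2 by ring,
    intervalIntegral.integral_add_adjacent_intervals (hi _ _) (hi _ _),
    intervalIntegral.integral_add_adjacent_intervals (hi _ _) (hi _ _),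
    intervalIntegral.integral_add_adjacent_intervals (hi _ _) (hi _ _)]

theorem speed_pi_sub (θ : ℝ) : speed (Real.pi - θ) = speed θ := by
  simp [speed, Real.sin_pi_sub, Real.cos_pi_sub]

theorem speed_pi_add (θ : ℝ) : speed (Real.pi + θ) = speed θ := by
  simp [speed, add_comm Real.pi]

theorem speed_two_pi_sub (θ : ℝ) : speed (2 * Real.pi - θ) = speed θ := by
  simp [speed]

theorem sin_pi_add' (θ : ℝ) : Real.sin (Real.pi + θ) = -Real.sin θ := by
  rw [add_comm, Real.sin_add_pi]

theorem cos_pi_add' (θ : ℝ) : Real.cos (Real.pi + θ) = -Real.cos θ := by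
  rw [add_comm, Real.cos_add_pi]

/-- Reflections in the axes preserve the speed. Hence odd moments cancel, and absolute values can be
estimated after summing over the four reflected points. -/
theorem integral_comp_mul_speed_eq_quarter {g : ℝ → ℝ → ℝ} (hg : Continuous fun x : ℝ × ℝ => g x.1 x.2) :
    ∫ θ in (0)..(2 * Real.pi), g (Real.cos θ) (Real.sin θ) * speed θ =
      ∫ θ in (0)..(Real.pi / 2),
        (g (Real.cos θ) (Real.sin θ) + g (-Real.cos θ) (Real.sin θ) +
          g (-Real.cos θ) (-Real.sin θ) + g (Real.cos θ) (-Real.sin θ)) * speed θ := by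
  have hc : Continuous fun θ => g (Real.cos θ) (Real.sin θ) * speed θ :=
    (hg.comp (by fun_prop : Continuous fun θ => (Real.cos θ, Real.sin θ))).mul continuous_speed
  rw [integral_eq_integral_quarter hc]
  refine intervalIntegral.integral_congr fun θ _ => ?_
  simp only [speed_pi_sub, speed_pi_add, speed_two_pi_sub, Real.sin_pi_sub, Real.cos_pi_sub,
    sin_pi_add', cos_pi_add', Real.sin_two_pi_sub, Real.cos_two_pi_sub]
  ring

/-! ### Moments -/

theorem integral_cos_mul_speed : ∫ θ in (0)..(2 * Real.pi), Real.cos θ * speed θ = 0 := by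
  rw [integral_comp_mul_speed_eq_quarter (g := fun x _ => x) (by fun_prop)]
  simp

theorem integral_sin_mul_speed : ∫ θ in (0)..(2 * Real.pi), Real.sin θ * speed θ = 0 := by
  rw [integral_comp_mul_speed_eq_quarter (g := fun _ y => y) (by fun_prop)]
  simp

theorem integral_cos_mul_sin_mul_speed :
    ∫ θ in (0)..(2 * Real.pi), Real.cos θ * Real.sin θ * speed θ = 0 := by
  rw [integral_comp_mul_speed_eq_quarter (g := fun x y => x * y) (by fun_prop)]
  simp

/-- The second moment of the minor-axis coordinate under the uniform distribution. -/
def sinSqMean : ℝ := (1 - cosMoment / perimeter) / 2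

theorem integral_sin_sq_mul_speed :
    ∫ θ in (0)..(2 * Real.pi), Real.sin θ ^ 2 * speed θ = perimeter * sinSqMean := by
  have h : ∀ θ, Real.sin θ ^ 2 * speed θ = 1 / 2 * speed θ - 1 / 2 * (Real.cos (2 * θ) * speed θ) := by
    intro θ
    rw [Real.sin_sq_eq_half_sub]; ring
  have hp := perimeter_pos
  simp_rw [h]
  rw [intervalIntegral.integral_sub (Continuous.intervalIntegrable (by fun_prop) _ _)
      (Continuous.intervalIntegrable (by fun_prop) _ _), intervalIntegral.integral_const_mul,
    intervalIntegral.integral_const_mul, ← perimeter, ← cosMoment, sinSqMean]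
  field_simp

theorem integral_quadratic_mul_speed (a b c d e f : ℝ) :
    ∫ θ in (0)..(2 * Real.pi),
      (a * Real.cos θ ^ 2 + b * Real.sin θ ^ 2 + c * (Real.cos θ * Real.sin θ) + d * Real.cos θ +
        e * Real.sin θ + f) * speed θ =
      perimeter * (a * (1 - sinSqMean) + b * sinSqMean + f) := by
  have h : ∀ θ, (a * Real.cos θ ^ 2 + b * Real.sin θ ^ 2 + c * (Real.cos θ * Real.sin θ) +
        d * Real.cos θ + e * Real.sin θ + f) * speed θ =
      (b - a) * (Real.sin θ ^ 2 * speed θ) + c * (Real.cos θ * Real.sin θ * speed θ) +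
        d * (Real.cos θ * speed θ) + e * (Real.sin θ * speed θ) + (a + f) * speed θ := by
    intro θ
    rw [Real.cos_sq']; ring
  simp_rw [h]
  rw [intervalIntegral.integral_add (Continuous.intervalIntegrable (by fun_prop) _ _)
      (Continuous.intervalIntegrable (by fun_prop) _ _),
    intervalIntegral.integral_add (Continuous.intervalIntegrable (by fun_prop) _ _)
      (Continuous.intervalIntegrable (by fun_prop) _ _),
    intervalIntegral.integral_add (Continuous.intervalIntegrable (by fun_prop) _ _)
      (Continuous.intervalIntegrable (by fun_prop) _ _),
    intervalIntegral.integral_add (Continuous.intervalIntegrable (by fun_prop) _ _)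
      (Continuous.intervalIntegrable (by fun_prop) _ _)]
  simp only [intervalIntegral.integral_const_mul, integral_sin_sq_mul_speed,
    integral_cos_mul_sin_mul_speed, integral_cos_mul_speed, integral_sin_mul_speed]
  have hp : ∫ θ in (0)..(2 * Real.pi), speed θ = perimeter := rfl
  rw [hp]
  ring

theorem integral_speed_quarter : ∫ θ in (0)..(Real.pi / 2), speed θ = perimeter / 4 := by
  have h := integral_comp_mul_speed_eq_quarter (g := fun _ _ => 1) (by fun_prop)
  have hp : ∫ θ in (0)..(2 * Real.pi), speed θ = perimeter := rfl
  simp only [one_mul, intervalIntegral.integral_const_mul, hp] at h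
  linarith

/-- The substitution u = sin θ turns this into the integral of √(1 + 3u²) over [0, 1], which has an
elementary primitive. -/
theorem integral_cos_mul_speed_quarter :
    ∫ θ in (0)..(Real.pi / 2), Real.cos θ * speed θ = 1 + Real.arsinh √3 / √3 / 2 := by
  have h3 : √3 ^ 2 = 3 := Real.sq_sqrt (by norm_num)
  have hs3 : 0 < √3 := by positivity
  have hd : ∀ u : ℝ, HasDerivAt
      (fun u => (u * √(1 + (√3 * u) ^ 2) + Real.arsinh (√3 * u) / √3) / 2)
      (√(1 + (√3 * u) ^ 2)) u := by
    intro u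
    have hq : (0 : ℝ) < 1 + (√3 * u) ^ 2 := by positivity
    have hq' := Real.sqrt_pos.2 hq
    have hsq := Real.sq_sqrt hq.le
    have h1 : HasDerivAt (fun u : ℝ => √3 * u) √3 u := by
      simpa using (hasDerivAt_id u).const_mul √3
    have h2 := ((h1.pow 2).const_add 1).sqrt hq.ne'
    have h4 := ((hasDerivAt_id u).mul h2).add ((h1.arsinh).div_const √3)
    have h5 := h4.div_const 2
    refine h5.congr_deriv ?_
    simp only [id, smul_eq_mul, Pi.pow_apply, Nat.cast_ofNat, one_mul]
    rw [show 2 - 1 = 1 from rfl, pow_one]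
    set q := √(1 + (√3 * u) ^ 2)
    field_simp
    linear_combination -hsq
  have hw : ∀ θ, speed θ = √(1 + (√3 * Real.sin θ) ^ 2) := by
    intro θ
    rw [mul_pow, h3, ← speed_sq, Real.sqrt_sq (speed_nonneg θ)]
  have h := intervalIntegral.integral_eq_sub_of_hasDerivAt (a := 0) (b := Real.pi / 2)
    (f' := fun θ => Real.cos θ * speed θ)
    (fun θ _ => ((hd (Real.sin θ)).comp θ (Real.hasDerivAt_sin θ)).congr_deriv
      (by rw [hw]; ring))
    (Continuous.intervalIntegrable (by fun_prop) _ _)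
  rw [h]
  simp [h3]
  rw [show (1 + 3 : ℝ) = 2 ^ 2 by norm_num, Real.sqrt_sq (by norm_num)]
  ring

/-- The first absolute moment of the major-axis coordinate under the uniform distribution. -/
def absCosMean : ℝ := (8 + 4 * (Real.arsinh √3 / √3)) / perimeter

theorem abs_absCosMean_sub_le : |absCosMean - 1.1396442169| ≤ 2 / 10 ^ 8 := by
  have h1 := abs_le.1 abs_perimeter_sub_le
  have h2 := abs_le.1 abs_arsinh_sqrt_three_div_sub_le
  have hp := perimeter_pos
  rw [absCosMean, abs_le]
  constructor
  · rw [neg_le_sub_iff_le_add, ← sub_le_iff_le_add, le_div_iff₀ hp]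
    linarith
  · rw [sub_le_iff_le_add, div_le_iff₀ hp]
    linarith

theorem abs_sinSqMean_sub_le : |sinSqMean - 0.57992330675| ≤ 2 / 10 ^ 8 := by
  have h1 := abs_le.1 abs_perimeter_sub_le
  have h2 := abs_le.1 abs_cosMoment_sub_le
  have hp := perimeter_pos
  have h3 : cosMoment / perimeter ≤ -0.1598466134 + 2 / 10 ^ 8 := by
    rw [div_le_iff₀ hp]
    linarith
  have h4 : -0.1598466136 - 2 / 10 ^ 8 ≤ cosMoment / perimeter := by
    rw [le_div_iff₀ hp]
    linarith
  rw [sinSqMean, abs_le]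
  constructor <;> linarith

/-! ### Rearrangement estimate -/

/-- With u = cos θ this is the integral of (k - 2u)₊ over [0, 1], at most the area k²/4 of the full
triangle. -/
theorem integral_max_sub_mul_sin_le {k : ℝ} (hk : 0 ≤ k) :
    ∫ θ in (0)..(Real.pi / 2), max (k - 2 * Real.cos θ) 0 * Real.sin θ ≤ k ^ 2 / 4 := by
  have h := intervalIntegral.integral_comp_mul_deriv (a := 0) (b := Real.pi / 2)
    (f := Real.cos) (f' := fun θ => -Real.sin θ) (g := fun u => max (k - 2 * u) 0)
    (fun θ _ => Real.hasDerivAt_cos θ) (by fun_prop) (by fun_prop)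
  have h' : ∫ θ in (0)..(Real.pi / 2), max (k - 2 * Real.cos θ) 0 * Real.sin θ =
      ∫ u in (0)..1, max (k - 2 * u) 0 := by
    rw [Real.cos_zero, Real.cos_pi_div_two] at h
    rw [intervalIntegral.integral_symm 1, ← h, ← intervalIntegral.integral_neg]
    simp
  rw [h']
  have hlin : ∀ b : ℝ, ∫ u in (0)..b, (k - 2 * u) = k * b - b ^ 2 := by
    intro b
    rw [intervalIntegral.integral_sub (by simp) (Continuous.intervalIntegrable (by fun_prop) _ _)]
    rw [intervalIntegral.integral_const_mul, integral_id, intervalIntegral.integral_const]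
    simp
    ring
  rcases le_total 2 k with h2 | h2
  · rw [intervalIntegral.integral_congr (g := fun u => k - 2 * u), hlin]
    · nlinarith [sq_nonneg (k - 2)]
    · intro u hu
      rw [uIcc_of_le zero_le_one] at hu
      exact max_eq_left (by linarith [hu.2])
  · rw [← intervalIntegral.integral_add_adjacent_intervals (b := k / 2)
      (Continuous.intervalIntegrable (by fun_prop) _ _)
      (Continuous.intervalIntegrable (by fun_prop) _ _),
      intervalIntegral.integral_congr (g := fun u => k - 2 * u) (b := k / 2), hlin,
      intervalIntegral.integral_congr (g := fun _ => 0) (a := k / 2)]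
    · simp
      nlinarith
    · intro u hu
      rw [uIcc_of_le (by linarith)] at hu
      exact max_eq_right (by linarith [hu.1])
    · intro u hu
      rw [uIcc_of_le (by linarith)] at hu
      exact max_eq_left (by linarith [hu.2])

/-- A Chebyshev-type comparison: on the quarter, speed and P sin θ have the same integral P, and
their difference changes sign once, from positive to negative. Since (k - 2 cos θ)₊ is increasing,
replacing speed by P sin θ can only enlarge the integral. -/
theorem integral_max_sub_mul_speed_le {k : ℝ} (hk : 0 ≤ k) :
    ∫ θ in (0)..(Real.pi / 2), max (k - 2 * Real.cos θ) 0 * speed θ ≤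
      perimeter / 4 * (k ^ 2 / 4) := by
  have hP := abs_le.1 abs_perimeter_sub_le
  set P := perimeter / 4 with hPdef
  have hP0 : 2.42 < P := by linarith
  have hP3 : 1 < P ^ 2 - 3 := by nlinarith
  -- `speed θ / sin θ` decreases through the value `P` where `sin θ = s`
  set s := √(1 / (P ^ 2 - 3)) with hs
  have hs2 : s ^ 2 * (P ^ 2 - 3) = 1 := by
    rw [hs, Real.sq_sqrt (by positivity)]
    field_simp
  have hs0 : 0 ≤ s := Real.sqrt_nonneg _
  -- The value of the increasing factor at the crossing point. Subtracting it makes the product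
  -- nonpositive pointwise, and leaves the integral unchanged because the two weights have equal
  -- mass.
  set m := max (k - 2 * √(1 - s ^ 2)) 0
  have hpt : ∀ θ ∈ Icc 0 (Real.pi / 2),
      (max (k - 2 * Real.cos θ) 0 - m) * (speed θ - P * Real.sin θ) ≤ 0 := by
    intro θ hθ
    have hsin : 0 ≤ Real.sin θ :=
      Real.sin_nonneg_of_nonneg_of_le_pi hθ.1 (by linarith [hθ.2, Real.pi_pos])
    have hcos : 0 ≤ Real.cos θ :=
      Real.cos_nonneg_of_neg_pi_div_two_le_of_le (by linarith [hθ.1, Real.pi_pos]) hθ.2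
    have hw := speed_sq θ
    have hw0 := speed_nonneg θ
    have hcs := Real.cos_sq' θ
    rcases le_total (Real.sin θ) s with h | h
    · have hsq : Real.sin θ ^ 2 ≤ s ^ 2 := pow_le_pow_left₀ hsin h 2
      refine mul_nonpos_of_nonpos_of_nonneg ?_ ?_
      · have : √(1 - s ^ 2) ≤ Real.cos θ := Real.sqrt_le_iff.2 ⟨hcos, by linarith⟩
        exact sub_nonpos.2 (max_le_max (by linarith) le_rfl)
      · refine sub_nonneg.2 ((sq_le_sq₀ (by positivity) hw0).1 ?_)
        nlinarith
    · have hsq : s ^ 2 ≤ Real.sin θ ^ 2 := pow_le_pow_left₀ hs0 h 2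
      refine mul_nonpos_of_nonneg_of_nonpos ?_ ?_
      · have : Real.cos θ ≤ √(1 - s ^ 2) := Real.le_sqrt_of_sq_le (by linarith)
        exact sub_nonneg.2 (max_le_max (by linarith) le_rfl)
      · refine sub_nonpos.2 ((sq_le_sq₀ hw0 (by positivity)).1 ?_)
        nlinarith
  have hint : ∫ θ in (0)..(Real.pi / 2),
      (max (k - 2 * Real.cos θ) 0 - m) * (speed θ - P * Real.sin θ) ≤ 0 := by
    rw [← neg_nonneg, ← intervalIntegral.integral_neg]
    exact intervalIntegral.integral_nonneg (by positivity) fun θ hθ => neg_nonneg.2 (hpt θ hθ)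
  have hexp : ∀ θ, (max (k - 2 * Real.cos θ) 0 - m) * (speed θ - P * Real.sin θ) =
      (max (k - 2 * Real.cos θ) 0 * speed θ - P * (max (k - 2 * Real.cos θ) 0 * Real.sin θ)) -
        (m * speed θ - m * P * Real.sin θ) := fun θ => by ring
  simp_rw [hexp] at hint
  rw [intervalIntegral.integral_sub (Continuous.intervalIntegrable (by fun_prop) _ _)
      (Continuous.intervalIntegrable (by fun_prop) _ _),
    intervalIntegral.integral_sub (Continuous.intervalIntegrable (by fun_prop) _ _)
      (Continuous.intervalIntegrable (by fun_prop) _ _),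
    intervalIntegral.integral_sub (Continuous.intervalIntegrable (by fun_prop) _ _)
      (Continuous.intervalIntegrable (by fun_prop) _ _),
    intervalIntegral.integral_const_mul, intervalIntegral.integral_const_mul,
    intervalIntegral.integral_const_mul, integral_speed_quarter, integral_sin, ← hPdef] at hint
  simp at hint
  have := mul_le_mul_of_nonneg_left (integral_max_sub_mul_sin_le hk) (by linarith : 0 ≤ P)
  linarith

/-! ### First absolute moments of affine functions -/

/-- The (unnormalised) first absolute moment of `x ↦ x₁ d₁ + x₂ d₂ - c` on the ellipse. -/
def absMoment (d₁ d₂ c : ℝ) : ℝ :=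
  ∫ θ in (0)..(2 * Real.pi), |2 * d₁ * Real.cos θ + d₂ * Real.sin θ - c| * speed θ

theorem absMoment_nonneg (d₁ d₂ c : ℝ) : 0 ≤ absMoment d₁ d₂ c :=
  intervalIntegral.integral_nonneg Real.two_pi_pos.le fun θ _ =>
    mul_nonneg (abs_nonneg _) (speed_nonneg θ)

theorem absMoment_mul (k d₁ d₂ c : ℝ) :
    absMoment (k * d₁) (k * d₂) (k * c) = |k| * absMoment d₁ d₂ c := by
  rw [absMoment, absMoment, ← intervalIntegral.integral_const_mul]
  refine intervalIntegral.integral_congr fun θ _ => ?_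
  rw [← mul_assoc |k|, ← abs_mul]
  ring_nf

/-- Nonnegativity of the variance of the absolute value, whose mean is `κ`. -/
theorem absMoment_sq_le (d₁ d₂ c : ℝ) :
    absMoment d₁ d₂ c ^ 2 ≤
      perimeter ^ 2 * (4 * d₁ ^ 2 * (1 - sinSqMean) + d₂ ^ 2 * sinSqMean + c ^ 2) := by
  have hp := perimeter_pos
  set κ := absMoment d₁ d₂ c / perimeter with hκ
  have h0 : 0 ≤ ∫ θ in (0)..(2 * Real.pi),
      (|2 * d₁ * Real.cos θ + d₂ * Real.sin θ - c| - κ) ^ 2 * speed θ :=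
    intervalIntegral.integral_nonneg Real.two_pi_pos.le fun θ _ =>
      mul_nonneg (sq_nonneg _) (speed_nonneg θ)
  have hexp : ∀ θ, (|2 * d₁ * Real.cos θ + d₂ * Real.sin θ - c| - κ) ^ 2 * speed θ =
      (4 * d₁ ^ 2 * Real.cos θ ^ 2 + d₂ ^ 2 * Real.sin θ ^ 2 +
        4 * d₁ * d₂ * (Real.cos θ * Real.sin θ) + (-4 * d₁ * c) * Real.cos θ +
        (-2 * d₂ * c) * Real.sin θ + (c ^ 2 + κ ^ 2)) * speed θ -
      2 * κ * (|2 * d₁ * Real.cos θ + d₂ * Real.sin θ - c| * speed θ) := by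
    intro θ
    rw [sub_sq, sq_abs]
    ring
  simp_rw [hexp] at h0
  rw [intervalIntegral.integral_sub (Continuous.intervalIntegrable (by fun_prop) _ _)
    (Continuous.intervalIntegrable (by fun_prop) _ _), integral_quadratic_mul_speed,
    intervalIntegral.integral_const_mul, ← absMoment] at h0
  have hH : absMoment d₁ d₂ c = κ * perimeter := by rw [hκ]; field_simp
  rw [hH] at h0 ⊢
  nlinarith

theorem abs_add_abs_sub_le {c v M : ℝ} (hc : 0 ≤ c) (hM : 0 ≤ M) (h : |v| - c ≤ M) :
    |c + v| + |-c + v| ≤ 2 * c + 2 * M := by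
  rcases abs_cases v with hv | hv <;> rcases abs_cases (c + v) with h1 | h1 <;>
    rcases abs_cases (-c + v) with h2 | h2 <;> linarith

/-- Here |c + v| + |-c + v| = 2c + 2(|v| - c)₊, and v ↦ (|v| - c)₊ is convex and even. The values v
= ±tu - s are convex combinations of t - s and -t - s with weights (1 ± u)/2, so the two
contributions add up to the endpoint values. -/
theorem sum_abs_le {c u : ℝ} (t s : ℝ) (hc : 0 ≤ c) (hu0 : 0 ≤ u) (hu1 : u ≤ 1) :
    |c + t * u - s| + |-c + t * u - s| + |-c - t * u - s| + |c - t * u - s| ≤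
      4 * c + 2 * max (|t - s| - c) 0 + 2 * max (|t + s| - c) 0 := by
  set α := max (|t - s| - c) 0
  set β := max (|t + s| - c) 0
  have hα : |t - s| ≤ α + c := by linarith [le_max_left (|t - s| - c) 0]
  have hβ : |t + s| ≤ β + c := by linarith [le_max_left (|t + s| - c) 0]
  have hα0 : 0 ≤ α := le_max_right _ _
  have hβ0 : 0 ≤ β := le_max_right _ _
  obtain ⟨a1, a2⟩ := abs_le.1 hα
  obtain ⟨b1, b2⟩ := abs_le.1 hβ
  have h1 := abs_add_abs_sub_le (v := t * u - s) (M := (1 + u) / 2 * α + (1 - u) / 2 * β) hc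
    (add_nonneg (mul_nonneg (by linarith) hα0) (mul_nonneg (by linarith) hβ0))
    (sub_le_iff_le_add.2 (abs_le.2 ⟨by nlinarith, by nlinarith⟩))
  have h2 := abs_add_abs_sub_le (v := -(t * u) - s) (M := (1 + u) / 2 * β + (1 - u) / 2 * α) hc
    (add_nonneg (mul_nonneg (by linarith) hβ0) (mul_nonneg (by linarith) hα0))
    (sub_le_iff_le_add.2 (abs_le.2 ⟨by nlinarith, by nlinarith⟩))
  rw [show c + t * u - s = c + (t * u - s) by ring, show -c + t * u - s = -c + (t * u - s) by ring,
    show -c - t * u - s = -c + (-(t * u) - s) by ring,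
    show c - t * u - s = c + (-(t * u) - s) by ring]
  linarith

theorem absMoment_one_le (t s : ℝ) :
    absMoment 1 t s ≤ perimeter * (absCosMean + (t ^ 2 + s ^ 2) / 4) := by
  have hfold := integral_comp_mul_speed_eq_quarter
    (g := fun x y => |2 * 1 * x + t * y - s|) (by fun_prop)
  rw [absMoment, hfold]
  have hle : ∫ θ in (0)..(Real.pi / 2),
      (|2 * 1 * Real.cos θ + t * Real.sin θ - s| + |2 * 1 * -Real.cos θ + t * Real.sin θ - s| +
        |2 * 1 * -Real.cos θ + t * -Real.sin θ - s| + |2 * 1 * Real.cos θ + t * -Real.sin θ - s|) *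
          speed θ ≤
      ∫ θ in (0)..(Real.pi / 2), (8 * (Real.cos θ * speed θ) +
        2 * (max (|t - s| - 2 * Real.cos θ) 0 * speed θ) +
        2 * (max (|t + s| - 2 * Real.cos θ) 0 * speed θ)) := by
    refine intervalIntegral.integral_mono_on (by positivity)
      (Continuous.intervalIntegrable (by fun_prop) _ _)
      (Continuous.intervalIntegrable (by fun_prop) _ _) fun θ hθ => ?_
    have hsin : 0 ≤ Real.sin θ :=
      Real.sin_nonneg_of_nonneg_of_le_pi hθ.1 (by linarith [hθ.2, Real.pi_pos])
    have hcos : 0 ≤ Real.cos θ :=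
      Real.cos_nonneg_of_neg_pi_div_two_le_of_le (by linarith [hθ.1, Real.pi_pos]) hθ.2
    have h := sum_abs_le (c := 2 * Real.cos θ) t s (by positivity) hsin (Real.sin_le_one θ)
    have h' := mul_le_mul_of_nonneg_right h (speed_nonneg θ)
    ring_nf at h' ⊢
    exact h'
  refine hle.trans ?_
  rw [intervalIntegral.integral_add (Continuous.intervalIntegrable (by fun_prop) _ _)
      (Continuous.intervalIntegrable (by fun_prop) _ _),
    intervalIntegral.integral_add (Continuous.intervalIntegrable (by fun_prop) _ _)
      (Continuous.intervalIntegrable (by fun_prop) _ _), intervalIntegral.integral_const_mul,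
    intervalIntegral.integral_const_mul, intervalIntegral.integral_const_mul,
    integral_cos_mul_speed_quarter]
  have h1 := integral_max_sub_mul_speed_le (abs_nonneg (t - s))
  have h2 := integral_max_sub_mul_speed_le (abs_nonneg (t + s))
  have h3 : perimeter * absCosMean = 8 + 4 * (Real.arsinh √3 / √3) := by
    rw [absCosMean, mul_div_cancel₀ _ perimeter_pos.ne']
  rw [sq_abs] at h1 h2
  linarith

/-- The linear part has amplitude at most |c|, so the affine function keeps one sign on the ellipse;
its linear part integrates to zero. -/
theorem absMoment_eq_of_le {d₁ d₂ c : ℝ} (h : 4 * d₁ ^ 2 + d₂ ^ 2 ≤ c ^ 2) :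
    absMoment d₁ d₂ c = perimeter * |c| := by
  have hle : ∀ θ, |2 * d₁ * Real.cos θ + d₂ * Real.sin θ| ≤ |c| := by
    intro θ
    rw [← sq_le_sq]
    nlinarith [Real.sin_sq_add_cos_sq θ, sq_nonneg (2 * d₁ * Real.sin θ - d₂ * Real.cos θ)]
  have hq := fun ε : ℝ => integral_quadratic_mul_speed 0 0 0 (-ε * (2 * d₁)) (-ε * d₂) (ε * c)
  rcases abs_cases c with ⟨hc, h0⟩ | ⟨hc, h0⟩ <;> rw [hc] at hle ⊢
  · have := hq 1
    simp only [zero_mul, zero_add, one_mul] at this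
    rw [← this, absMoment]
    refine intervalIntegral.integral_congr fun θ _ => ?_
    rw [abs_of_nonpos (by linarith [(abs_le.1 (hle θ)).2])]
    ring
  · have := hq (-1)
    simp only [zero_mul, zero_add, neg_one_mul] at this
    rw [← this, absMoment]
    refine intervalIntegral.integral_congr fun θ _ => ?_
    rw [abs_of_nonneg (by linarith [(abs_le.1 (hle θ)).1])]
    ring

theorem absMoment_one_sq_lt {t s : ℝ} (ht : t ^ 2 ≤ 1) (hts : t ≠ 0 ∨ s ≠ 0) :
    absMoment 1 t s ^ 2 < perimeter ^ 2 * (absCosMean ^ 2 * (1 + t ^ 2) + s ^ 2) := by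
  have ha := abs_le.1 abs_absCosMean_sub_le
  have hp := perimeter_pos
  have hH0 := absMoment_nonneg 1 t s
  have hts' : 0 < t ^ 2 + s ^ 2 := by
    rcases hts with h | h <;> positivity
  -- With q = t² + s², (a + q/4)² = a² + q(a/2 + q/16), and the bracket stays below 1 up to q = 6.8.
  -- Beyond that, t² ≤ 1 forces s² ≥ 5.8 > 4 + t², the one-signed case.
  rcases le_total (t ^ 2 + s ^ 2) 6.8 with hq | hq
  · refine (pow_le_pow_left₀ hH0 (absMoment_one_le t s) 2).trans_lt ?_
    rw [mul_pow]
    refine mul_lt_mul_of_pos_left ?_ (by positivity)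
    have h1 : 1 ≤ absCosMean ^ 2 := by nlinarith
    have h2 : absCosMean / 2 + (t ^ 2 + s ^ 2) / 16 < 1 := by linarith
    nlinarith [mul_pos hts' (sub_pos.2 h2), mul_nonneg (sub_nonneg.2 h1) (sq_nonneg t)]
  · rw [absMoment_eq_of_le (by linarith), mul_pow, sq_abs]
    refine mul_lt_mul_of_pos_left ?_ (by positivity)
    have : 0 < absCosMean ^ 2 * (1 + t ^ 2) := by
      have : 0 < absCosMean := by linarith
      positivity
    linarith

theorem absMoment_one_zero_zero : absMoment 1 0 0 = perimeter * absCosMean := by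
  have hp := perimeter_pos
  refine le_antisymm (by simpa using absMoment_one_le 0 0) ?_
  have hfold := integral_comp_mul_speed_eq_quarter
    (g := fun x y => |2 * 1 * x + 0 * y - 0|) (by fun_prop)
  rw [absMoment, hfold]
  have hge : ∫ θ in (0)..(Real.pi / 2), 8 * (Real.cos θ * speed θ) ≤
      ∫ θ in (0)..(Real.pi / 2),
      (|2 * 1 * Real.cos θ + 0 * Real.sin θ - 0| + |2 * 1 * -Real.cos θ + 0 * Real.sin θ - 0| +
        |2 * 1 * -Real.cos θ + 0 * -Real.sin θ - 0| + |2 * 1 * Real.cos θ + 0 * -Real.sin θ - 0|) *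
          speed θ := by
    refine intervalIntegral.integral_mono_on (by positivity)
      (Continuous.intervalIntegrable (by fun_prop) _ _)
      (Continuous.intervalIntegrable (by fun_prop) _ _) fun θ _ => ?_
    have h1 := le_abs_self (2 * Real.cos θ)
    have hs := speed_nonneg θ
    simp only [zero_mul, neg_zero, add_zero, sub_zero, mul_one, mul_neg, abs_neg]
    nlinarith
  refine le_trans (le_of_eq ?_) hge
  rw [intervalIntegral.integral_const_mul, integral_cos_mul_speed_quarter, absCosMean,
    mul_div_cancel₀ _ hp.ne']
  ring

/-- The sharp bound on first absolute moments of affine functions, in its strict form. -/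
theorem absMoment_sq_lt {d₁ d₂ c : ℝ} (h : d₂ ≠ 0 ∨ c ≠ 0) (hd : d₁ ≠ 0 ∨ d₂ ≠ 0) :
    absMoment d₁ d₂ c ^ 2 <
      perimeter ^ 2 * (absCosMean ^ 2 * (d₁ ^ 2 + d₂ ^ 2) + c ^ 2) := by
  have hp := perimeter_pos
  -- The second-moment coefficients are about 1.68 for d₁² and 0.58 for d₂², against a² ≈ 1.30; the
  -- excess in the first is absorbed by the second once d₁² ≤ d₂².
  rcases le_or_gt (d₁ ^ 2) (d₂ ^ 2) with hle | hlt
  · refine (absMoment_sq_le d₁ d₂ c).trans_lt (mul_lt_mul_of_pos_left ?_ (by positivity))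
    have ha := abs_le.1 abs_absCosMean_sub_le
    have hy := abs_le.1 abs_sinSqMean_sub_le
    have ha2 : 1.29 ≤ absCosMean ^ 2 := by nlinarith
    have hd₂ : 0 < d₂ ^ 2 := by
      rcases hd with h | h
      · have : 0 < d₁ ^ 2 := by positivity
        linarith
      · positivity
    have hd₁ := sq_nonneg d₁
    nlinarith
  · have hd₁ : d₁ ≠ 0 := by
      rintro rfl
      nlinarith [sq_nonneg d₂]
    have ht : (d₂ / d₁) ^ 2 ≤ 1 := by
      rw [div_pow, div_le_one (by positivity)]
      exact hlt.le
    have hts : d₂ / d₁ ≠ 0 ∨ c / d₁ ≠ 0 := by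
      rcases h with h | h
      · exact Or.inl (div_ne_zero h hd₁)
      · exact Or.inr (div_ne_zero h hd₁)
    have hm := absMoment_mul d₁ 1 (d₂ / d₁) (c / d₁)
    rw [mul_one, mul_div_cancel₀ _ hd₁, mul_div_cancel₀ _ hd₁] at hm
    rw [hm, mul_pow, sq_abs]
    have := mul_lt_mul_of_pos_left (absMoment_one_sq_lt ht hts) (by positivity : 0 < d₁ ^ 2)
    refine this.trans_eq ?_
    field_simp

theorem absMoment_zero_zero (d₁ : ℝ) :
    absMoment d₁ 0 0 = |d₁| * (perimeter * absCosMean) := by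
  rw [← absMoment_one_zero_zero, ← absMoment_mul, mul_one, mul_zero]

/-! ### Optimal pairs -/

/-- The least distortion of a pair of points. -/
def optimalPairDistortion : ℝ := 4 - 3 * sinSqMean - absCosMean ^ 2

theorem abs_optimalPairDistortion_sub_lt : |optimalPairDistortion - 0.961441| < 0.0000005 := by
  have ha := abs_le.1 abs_absCosMean_sub_le
  have hy := abs_le.1 abs_sinSqMean_sub_le
  have h1 := mul_nonneg (sub_nonneg.2 ha.1) (sub_nonneg.2 ha.2)
  have h2 := sq_nonneg (absCosMean - 1.1396442169)
  rw [optimalPairDistortion, abs_lt]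
  constructor <;> nlinarith

/-- Write min(x, y) = (x + y)/2 - |x - y|/2: the difference of the two squared distances is affine
in the point, and the linear terms of their mean integrate to zero. -/
theorem pairDistortion_eq (p₁ p₂ q₁ q₂ : ℝ) :
    pairDistortion p₁ p₂ q₁ q₂ =
      4 - 3 * sinSqMean + (p₁ ^ 2 + p₂ ^ 2 + q₁ ^ 2 + q₂ ^ 2) / 2 -
        absMoment (p₁ - q₁) (p₂ - q₂) ((p₁ ^ 2 + p₂ ^ 2 - q₁ ^ 2 - q₂ ^ 2) / 2) / perimeter := by
  have hp := perimeter_pos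
  have hmin : ∀ x y : ℝ, min x y = (x + y) / 2 - |x - y| / 2 := by
    intro x y
    rcases le_total x y with h | h
    · rw [min_eq_left h, abs_of_nonpos (sub_nonpos.2 h)]
      ring
    · rw [min_eq_right h, abs_of_nonneg (sub_nonneg.2 h)]
      ring
  have hexp : ∀ θ, min ((2 * Real.cos θ - p₁) ^ 2 + (Real.sin θ - p₂) ^ 2)
      ((2 * Real.cos θ - q₁) ^ 2 + (Real.sin θ - q₂) ^ 2) * speed θ =
      (4 * Real.cos θ ^ 2 + 1 * Real.sin θ ^ 2 + 0 * (Real.cos θ * Real.sin θ) +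
        (-2 * (p₁ + q₁)) * Real.cos θ + (-(p₂ + q₂)) * Real.sin θ +
        (p₁ ^ 2 + p₂ ^ 2 + q₁ ^ 2 + q₂ ^ 2) / 2) * speed θ -
      |2 * (p₁ - q₁) * Real.cos θ + (p₂ - q₂) * Real.sin θ -
        (p₁ ^ 2 + p₂ ^ 2 - q₁ ^ 2 - q₂ ^ 2) / 2| * speed θ := by
    intro θ
    rw [hmin, ← abs_neg (_ - (_ : ℝ) / 2)]
    have : ∀ x : ℝ, |2 * x| = 2 * |x| := fun x => by rw [abs_mul, abs_two]
    rw [show (2 * Real.cos θ - p₁) ^ 2 + (Real.sin θ - p₂) ^ 2 -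
      ((2 * Real.cos θ - q₁) ^ 2 + (Real.sin θ - q₂) ^ 2) =
      2 * -(2 * (p₁ - q₁) * Real.cos θ + (p₂ - q₂) * Real.sin θ -
        (p₁ ^ 2 + p₂ ^ 2 - q₁ ^ 2 - q₂ ^ 2) / 2) by ring, this]
    ring
  rw [pairDistortion]
  simp_rw [hexp]
  rw [intervalIntegral.integral_sub (Continuous.intervalIntegrable (by fun_prop) _ _)
    (Continuous.intervalIntegrable (by fun_prop) _ _), integral_quadratic_mul_speed, ← absMoment]
  field_simp
  ring

theorem pairDistortion_neg (a : ℝ) (ha : 0 ≤ a) :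
    pairDistortion a 0 (-a) 0 = 4 - 3 * sinSqMean + a ^ 2 - 2 * a * absCosMean := by
  have hp := perimeter_pos
  rw [pairDistortion_eq]
  rw [show (a ^ 2 + 0 ^ 2 - (-a) ^ 2 - 0 ^ 2) / 2 = 0 by ring, sub_zero, absMoment_zero_zero,
    abs_of_nonneg (by linarith)]
  field_simp
  ring

theorem absCosMean_pos : 0 < absCosMean := by
  linarith [(abs_le.1 abs_absCosMean_sub_le).1]

theorem pairDistortion_absCosMean :
    pairDistortion absCosMean 0 (-absCosMean) 0 = optimalPairDistortion := by
  rw [pairDistortion_neg _ absCosMean_pos.le, optimalPairDistortion]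
  ring

/-- Every pair other than the symmetric one on the major axis has larger distortion. -/
theorem optimalPairDistortion_lt_or (p₁ p₂ q₁ q₂ : ℝ) :
    optimalPairDistortion < pairDistortion p₁ p₂ q₁ q₂ ∨
      (p₂ = 0 ∧ q₂ = 0 ∧ ((p₁ = absCosMean ∧ q₁ = -absCosMean) ∨
        (p₁ = -absCosMean ∧ q₁ = absCosMean))) := by
  have hp := perimeter_pos
  have ha := absCosMean_pos
  rw [pairDistortion_eq, optimalPairDistortion]
  set a := absCosMean
  set d₁ := p₁ - q₁ with hd₁
  set d₂ := p₂ - q₂ with hd₂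
  set c := (p₁ ^ 2 + p₂ ^ 2 - q₁ ^ 2 - q₂ ^ 2) / 2 with hc
  -- The only case where the moment inequality may be an equality. Then q₁ = ±p₁: equal points are
  -- worse, and opposite signs leave the excess (|p₁| - a)² + p₂².
  by_cases hdeg : d₂ = 0 ∧ c = 0
  · obtain ⟨h2, h0⟩ := hdeg
    rw [h2, h0, absMoment_zero_zero]
    have hq₂ : q₂ = p₂ := by linarith
    have hsq : p₁ ^ 2 = q₁ ^ 2 := by rw [hq₂] at hc; linarith
    rw [show |d₁| * (perimeter * a) / perimeter = |d₁| * a by field_simp]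
    rcases sq_eq_sq_iff_eq_or_eq_neg.1 hsq with h | h
    · left
      rw [hd₁, h, sub_self, abs_zero]
      nlinarith [sq_nonneg q₁, sq_nonneg q₂, sq_nonneg p₂]
    · have hd : d₁ = 2 * p₁ := by linarith
      rw [hd, abs_mul, abs_two, hq₂, ← hsq]
      by_cases hfin : |p₁| = a ∧ p₂ = 0
      · right
        refine ⟨hfin.2, hfin.2, ?_⟩
        rcases (abs_eq ha.le).1 hfin.1 with h' | h'
        · exact Or.inl ⟨h', by linarith⟩
        · exact Or.inr ⟨h', by linarith⟩
      · left
        have h1 : 0 < (|p₁| - a) ^ 2 + p₂ ^ 2 := by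
          by_cases hz : p₂ = 0
          · have : |p₁| - a ≠ 0 := fun h => hfin ⟨by linarith, hz⟩
            positivity
          · positivity
        nlinarith [sq_abs p₁]
  · left
    have hor : d₂ ≠ 0 ∨ c ≠ 0 := by
      by_contra! hh
      exact hdeg hh
    have hdne : d₁ ≠ 0 ∨ d₂ ≠ 0 := by
      by_contra! hh
      have e1 : p₁ = q₁ := by linarith [hh.1]
      have e2 : p₂ = q₂ := by linarith [hh.2]
      exact hdeg ⟨hh.2, by rw [hc, e1, e2]; ring⟩
    have hlt := absMoment_sq_lt hor hdne
    set M := ((p₁ + q₁) / 2) ^ 2 + ((p₂ + q₂) / 2) ^ 2 with hM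
    set R := d₁ ^ 2 + d₂ ^ 2 with hR
    -- Cauchy-Schwarz for c = ⟨m, d⟩, with m the midpoint, M = ‖m‖² and R = ‖d‖².
    have hcs : c ^ 2 ≤ M * R := by
      have : c = (p₁ + q₁) / 2 * d₁ + (p₂ + q₂) / 2 * d₂ := by rw [hc, hd₁, hd₂]; ring
      rw [this, hM, hR]
      nlinarith [sq_nonneg ((p₁ + q₁) / 2 * d₂ - (p₂ + q₂) / 2 * d₁)]
    have hM0 : 0 ≤ M := by positivity
    have hR0 : 0 ≤ R := by positivity
    have hS : (p₁ ^ 2 + p₂ ^ 2 + q₁ ^ 2 + q₂ ^ 2) / 2 = M + R / 4 := by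
      rw [hM, hR, hd₁, hd₂]; ring
    have hb : absMoment d₁ d₂ c < perimeter * (M + R / 4 + a ^ 2) := by
      refine lt_of_pow_lt_pow_left₀ 2 (by positivity) (hlt.trans_le ?_)
      rw [mul_pow]
      refine mul_le_mul_of_nonneg_left ?_ (by positivity)
      -- AM-GM: a²R + c² ≤ (a² + M)R = 4 (M + a²)(R/4) ≤ (M + a² + R/4)².
      nlinarith [sq_nonneg (R / 4 - (M + a ^ 2))]
    have hb' : absMoment d₁ d₂ c / perimeter < M + R / 4 + a ^ 2 := by
      rwa [div_lt_iff₀ hp, mul_comm]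
    rw [hS]
    linarith

theorem optimalPairDistortion_le (p₁ p₂ q₁ q₂ : ℝ) :
    optimalPairDistortion ≤ pairDistortion p₁ p₂ q₁ q₂ := by
  rcases optimalPairDistortion_lt_or p₁ p₂ q₁ q₂ with h | ⟨rfl, rfl, ⟨rfl, rfl⟩ | ⟨rfl, rfl⟩⟩
  · exact h.le
  · exact pairDistortion_absCosMean.ge
  · rw [← pairDistortion_absCosMean, pairDistortion, pairDistortion]
    simp_rw [min_comm]
    exact le_rfl

theorem optimalPairDistortion_pos : 0 < optimalPairDistortion := by
  linarith [(abs_lt.1 abs_optimalPairDistortion_sub_lt).1]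

/-! ### From pairs to sets of at most two points -/

theorem encard_pair_le_two {E : Type*} (x y : E) : ({x, y} : Set E).encard ≤ 2 := by
  refine (encard_insert_le {y} x).trans_eq ?_
  rw [encard_singleton]
  exact one_add_one_eq_two

theorem eq_empty_or_pair_of_encard_le_two {E : Type*} {α : Set E} (h : α.encard ≤ 2) :
    α = ∅ ∨ ∃ p q, α = {p, q} := by
  rcases Set.eq_empty_or_nonempty α with h0 | ⟨p, hp⟩
  · exact Or.inl h0
  · right
    rcases Set.eq_empty_or_nonempty (α \ {p}) with h1 | ⟨q, hq⟩
    · refine ⟨p, p, ?_⟩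
      rw [pair_eq_singleton]
      exact (subset_singleton_iff_eq.1 (sdiff_eq_empty.1 h1)).resolve_left (Set.Nonempty.ne_empty ⟨p, hp⟩)
    · refine ⟨p, q, ?_⟩
      have hsub : ({p, q} : Set E) ⊆ α := by
        rintro x (rfl | rfl)
        · exact hp
        · exact hq.1
      refine ((Set.toFinite {p, q}).eq_of_subset_of_encard_le hsub ?_).symm
      rw [encard_pair (fun h => hq.2 h.symm)]
      exact h

theorem quantizationError_two_ellipseUniform :
    quantizationError 2 ellipseUniform = ENNReal.ofReal optimalPairDistortion := by
  refine le_antisymm ?_ ?_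
  · refine (iInf₂_le ({!₂[absCosMean, 0], !₂[-absCosMean, 0]} : Set Plane) ?_).trans_eq ?_
    · exact_mod_cast encard_pair_le_two _ _
    · rw [distortion_pair]
      simp [pairDistortion_absCosMean]
  · refine le_iInf₂ fun α hα => ?_
    rcases eq_empty_or_pair_of_encard_le_two (by exact_mod_cast hα) with rfl | ⟨p, q, rfl⟩
    · rw [distortion_empty]
      exact le_top
    · rw [distortion_pair]
      exact ENNReal.ofReal_le_ofReal (optimalPairDistortion_le _ _ _ _)

theorem isOptimalSetOfMeans_two_ellipseUniform_iff (α : Set Plane) :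
    IsOptimalSetOfMeans 2 ellipseUniform α ↔
      α = {!₂[absCosMean, 0], !₂[-absCosMean, 0]} := by
  constructor
  · rintro ⟨hα, h⟩
    rw [quantizationError_two_ellipseUniform] at h
    rcases eq_empty_or_pair_of_encard_le_two (by exact_mod_cast hα) with rfl | ⟨p, q, rfl⟩
    · rw [distortion_empty] at h
      exact absurd h.symm ENNReal.ofReal_ne_top
    · rw [distortion_pair, ENNReal.ofReal_eq_ofReal_iff (pairDistortion_nonneg _ _ _ _)
        optimalPairDistortion_pos.le] at h
      have hext : ∀ (x : Plane) (b : ℝ), x 0 = b → x 1 = 0 → x = !₂[b, 0] := by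
        intro x b h0 h1
        ext i
        fin_cases i
        · simpa using h0
        · simpa using h1
      rcases optimalPairDistortion_lt_or (p 0) (p 1) (q 0) (q 1) with
        hlt | ⟨hp, hq, ⟨h1, h2⟩ | ⟨h1, h2⟩⟩
      · exact absurd h hlt.ne'
      · rw [hext p _ h1 hp, hext q _ h2 hq]
      · rw [hext p _ h1 hp, hext q _ h2 hq, pair_comm]
  · rintro rfl
    refine ⟨by exact_mod_cast encard_pair_le_two _ _, ?_⟩
    rw [quantizationError_two_ellipseUniform, distortion_pair]
    simp [pairDistortion_absCosMean]

end

theorem mainTheorem10 :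
    ∃ a : ℝ, |a - 1.13964| < 0.000005 ∧
      (∀ α : Set Plane, IsOptimalSetOfMeans 2 ellipseUniform α ↔ α = {!₂[a, 0], !₂[-a, 0]}) ∧
      quantizationError 2 ellipseUniform ≠ ∞ ∧
      |(quantizationError 2 ellipseUniform).toReal - 0.961441| < 0.0000005 := by
  refine ⟨absCosMean, ?_, isOptimalSetOfMeans_two_ellipseUniform_iff, ?_, ?_⟩
  · have ha := abs_le.1 abs_absCosMean_sub_le
    rw [abs_lt]
    constructor <;> linarith
  · rw [quantizationError_two_ellipseUniform]
    exact ENNReal.ofReal_ne_top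
  · rw [quantizationError_two_ellipseUniform, ENNReal.toReal_ofReal optimalPairDistortion_pos.le]
    exact abs_optimalPairDistortion_sub_lt
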